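/- Let $\mathcal F$ be a totally ordered abelian group, written additively, and let $\mathcal L$ be a commutative ring (with $1$). Let $\mathcal R$ be the commutative ELT ring over $(\mathcal F,\mathcal L)$: its elements are the symbols $a^{[\ell]}$ with tangible value $a\in\mathcal F$ and layer $\ell\in\mathcal L$, with $$a_1^{[\ell_1]}+a_2^{[\ell_2]}=\begin{cases}a_1^{[\ell_1]}&a_1>a_2\\ a_2^{[\ell_2]}&a_1<a_2\\ a_1^{[\ell_1+\ell_2]}&a_1=a_2\end{cases}\qquad\text{and}\qquad a_1^{[\ell_1]}\cdot a_2^{[\ell_2]}=(a_1+a_2)^{[\ell_1\ell_2]},$$ so that $0^{[1]}$ is the multiplicative identity. Let $\overline{\mathcal R}=\mathcal R\cup\{-\infty\}$, where $-\infty$ is neutral for addition and absorbing for multiplication. Put $s(a^{[\ell]})=\ell$ and $s(-\infty)=0$, and let $\mathcal R^\times=\{\alpha\in\mathcal R : s(\alpha)\neq 0\}$. For $A=(a_{i,j})\in\overline{\mathcal R}^{\,n\times n}$ let $$\det A=\sum_{\sigma\in A_n}\prod_{i=1}^n a_{i,\sigma(i)}+0^{[-1]}\cdot\sum_{\sigma\in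 S_n\setminus A_n}\prod_{i=1}^n a_{i,\sigma(i)} ,$$ where $A_n\subseteq S_n$ is the alternating group. Call vectors $u_1,\dots,u_m\in\overline{\mathcal R}^{\,k}$ linearly independent if, for all $v_1,\dots,v_m\in\mathcal R^\times\cup\{-\infty\}$, whenever every entry of $\sum_j v_ju_j$ has layer $0$ (that is, is mapped to $0$ by $s$), one has $v_1=\dots=v_m=-\infty$. **Theorem.** Let $A\in\overline{\mathcal R}^{\,n\times n}$. If $\det A$ is an invertible element of $\mathcal R$, then the columns of $A$ are linearly independent, and the rows of $A$ are linearly independent. In other words, if $v\in(\mathcal R^\times\cup\{-\infty\})^n$ and all entries of $Av$ have layer $0$, or all entries of $A^{t}v$ have layer $0$, then $v=(-\infty,\dots,-\infty)$. -/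

import Mathlib

/-- The underlying set of the exploded layered tropical (ELT) algebra over a value set `F` and a
layering set `L`: an element is a tangible value `a : F` together with a layer `ℓ : L`. -/
@[ext]
structure ELT (F L : Type*) where
  tangible : F
  layer : L

namespace ELT

variable {F L : Type*}

/-- Addition: the element with the larger tangible value wins; layers add up in case of a tie. -/
instance [LinearOrder F] [Add L] : Add (ELT F L) where
  add x y :=
    if y.tangible < x.tangible then x
    else if x.tangible < y.tangible then y
    else ⟨x.tangible, x.layer + y.layer⟩

/-- Multiplication: tangible values add up, layers are multiplied. -/
instance [Add F] [Mul L] : Mul (ELT F L) where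
  mul x y := ⟨x.tangible + y.tangible, x.layer * y.layer⟩

/-- The multiplicative identity has tangible value `0` and layer `1`. -/
instance [Zero F] [One L] : One (ELT F L) where
  one := ⟨0, 1⟩

theorem add_def [LinearOrder F] [Add L] (x y : ELT F L) :
    x + y = if y.tangible < x.tangible then x
      else if x.tangible < y.tangible then y
      else ⟨x.tangible, x.layer + y.layer⟩ := rfl

theorem mul_def [Add F] [Mul L] (x y : ELT F L) :
    x * y = ⟨x.tangible + y.tangible, x.layer * y.layer⟩ := rfl

theorem one_def [Zero F] [One L] : (1 : ELT F L) = ⟨0, 1⟩ := rfl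

instance [LinearOrder F] [AddCommSemigroup L] : AddCommSemigroup (ELT F L) where
  add_assoc x y z := by
    obtain ⟨a, k⟩ := x
    obtain ⟨b, l⟩ := y
    obtain ⟨c, m⟩ := z
    simp only [add_def]
    grind [add_assoc]
  add_comm x y := by
    obtain ⟨a, k⟩ := x
    obtain ⟨b, l⟩ := y
    simp only [add_def]
    grind [add_comm]

instance [AddCommMonoid F] [CommMonoid L] : CommMonoid (ELT F L) where
  mul_assoc x y z := by simp [mul_def, add_assoc, mul_assoc]
  mul_comm x y := by simp [mul_def, add_comm, mul_comm]
  one_mul x := by simp [mul_def, one_def]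
  mul_one x := by simp [mul_def, one_def]

instance [AddCommGroup F] [LinearOrder F] [IsOrderedAddMonoid F] [CommRing L] :
    Distrib (ELT F L) where
  left_distrib x y z := by
    simp only [mul_def, add_def, add_lt_add_iff_left]
    split_ifs with h₁ h₂
    · rfl
    · rfl
    · simp [mul_add]
  right_distrib x y z := by
    simp only [mul_def, add_def, add_lt_add_iff_right]
    split_ifs with h₁ h₂
    · rfl
    · rfl
    · simp [add_mul]

/-- The commutative ELT ring `ELT F L` with an element `-∞` adjoined, which is neutral for addition
and absorbing for multiplication. In `WithZero (ELT F L)` the element `-∞` is written `0`. -/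
abbrev Bar (F L : Type*) : Type _ := WithZero (ELT F L)

/-- `Bar F L` is a commutative semiring under the operations that `WithZero` extends from
`ELT F L`. -/
instance [AddCommGroup F] [LinearOrder F] [IsOrderedAddMonoid F] [CommRing L] :
    CommSemiring (Bar F L) where
  __ := (inferInstance : AddCommMonoid (WithZero (ELT F L)))
  __ := (inferInstance : CommMonoidWithZero (WithZero (ELT F L)))
  __ := (inferInstance : Distrib (WithZero (ELT F L)))

/-- The element `-∞`. -/
def negInf {F L : Type*} : Bar F L := 0

/-- The sorting map: the layer of an element, with `s (-∞) = 0`. -/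
def s [Zero L] : Bar F L → L
  | none => 0
  | some x => x.layer

/-- The set `R^× ∪ {-∞}`, where `R^×` consists of the elements of nonzero layer. -/
def nonzeroLayerBar (F L : Type*) [Zero L] : Set (Bar F L) :=
  {x | x = negInf ∨ s x ≠ 0}

section Ring

variable [AddCommGroup F] [LinearOrder F] [IsOrderedAddMonoid F] [CommRing L]

/-- The negation map: multiplication by the element of tangible value `0` and layer `-1`. -/
def negation (x : Bar F L) : Bar F L := ((⟨0, -1⟩ : ELT F L) : Bar F L) * x

/-- The ELT determinant: the sum over the even permutations plus the negation of the sum over the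
odd ones. -/
def det {n : ℕ} (A : Matrix (Fin n) (Fin n) (Bar F L)) : Bar F L :=
  (∑ σ : Equiv.Perm (Fin n) with Equiv.Perm.sign σ = 1, ∏ i, A i (σ i)) +
    negation (∑ σ : Equiv.Perm (Fin n) with Equiv.Perm.sign σ = -1, ∏ i, A i (σ i))

/-- Vectors `u 0, …, u (m - 1)` in `(R ∪ {-∞})^k` are linearly independent if a linear combination
with coefficients in `R^× ∪ {-∞}` has all its entries of layer zero only when all the coefficients
are `-∞`. -/
def LinIndep {m k : ℕ} (u : Fin m → Fin k → Bar F L) : Prop :=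
  ∀ v : Fin m → Bar F L, (∀ j, v j ∈ nonzeroLayerBar F L) →
    (∀ i, s ((∑ j, v j • u j) i) = 0) → ∀ j, v j = negInf

end Ring

end ELT

/-! The tangible value `D` of `det A` is the maximal weight of a permutation. Linear programming
duality (`exists_bounds_of_val_det`, via `exists_potential`) bounds the value of each entry by `u i
+ w j`, with all the bounds summing to `D`. The layers of the entries attaining their bound form a
matrix over `L` whose ordinary determinant is the layer of `det A`, hence a unit
(`det_leadingMatrix`). The top-value layers of a dependence lie in the kernel of this matrix, so
they vanish, although one of them is nonzero (`linIndep_col_of_isUnit_det_leadingMatrix`). Rows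
follow by transposing and exchanging `u` and `w`. -/

section Potential

variable {ι G : Type*}

/-- The weight of the walk that starts at `i` and then visits the vertices of the list. -/
def walkWeight [AddMonoid G] (b : ι → ι → G) : ι → List ι → G
  | _, [] => 0
  | i, j :: l => b i j + walkWeight b j l

theorem walkWeight_append_cons [AddMonoid G] (b : ι → ι → G) (i k : ι) (l₁ l₂ : List ι) :
    walkWeight b i (l₁ ++ k :: l₂) = walkWeight b i (l₁ ++ [k]) + walkWeight b k l₂ := by
  induction l₁ generalizing i with
  | nil => simp [walkWeight]
  | cons j l ih => simp [walkWeight, ih, add_assoc]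

/-- A walk without repeated vertices, closed up by an edge to `t`, is the weight of a permutation
whose edge into the initial vertex is redirected to `t`. -/
theorem exists_perm_sum_eq_walkWeight [Fintype ι] [DecidableEq ι] [AddCommMonoid G]
    (b : ι → ι → G) (hb : ∀ i, b i i = 0) (i : ι) (l : List ι) (hl : (i :: l).Nodup) (t : ι) :
    ∃ σ : Equiv.Perm ι, (∀ m ∉ i :: l, σ m = m) ∧
      ∑ m, b m (if σ m = i then t else σ m) = walkWeight b i (l ++ [t]) := by
  induction l generalizing i with
  | nil =>
    refine ⟨1, fun _ _ => rfl, ?_⟩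
    rw [Finset.sum_eq_single i]
    · simp [walkWeight]
    · intro m _ hm
      simp [hm, hb]
    · simp
  | cons j l ih =>
    obtain ⟨σ, hσ, hsum⟩ := ih j hl.of_cons
    have hi : i ∉ j :: l := (List.nodup_cons.mp hl).1
    have hij : i ≠ j := fun h => hi (by simp [h])
    have hσi : σ i = i := hσ i hi
    -- The swap splices `i` into the cycle just before `j`: now `i` maps to `j`, and the vertex that
    -- `σ` sent to `j` maps to `i`.
    refine ⟨Equiv.swap i j * σ, fun m hm => ?_, ?_⟩
    · have hm' : m ∉ j :: l := fun h => hm (List.mem_cons_of_mem _ h)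
      rw [Equiv.Perm.mul_apply, hσ m hm']
      exact Equiv.swap_apply_of_ne_of_ne (fun h => hm (by simp [h])) (fun h => hm' (by simp [h]))
    · change _ = b i j + walkWeight b j (l ++ [t])
      rw [← hsum, ← Finset.add_sum_erase _ _ (Finset.mem_univ i),
        ← Finset.add_sum_erase (a := i) _ (fun m => b m (if σ m = j then t else σ m))
          (Finset.mem_univ i)]
      simp only [Equiv.Perm.mul_apply, hσi, Equiv.swap_apply_left, hij, hij.symm, if_false, hb,
        zero_add]
      congr 1
      refine Finset.sum_congr rfl fun m hm => ?_
      have hmi : σ m ≠ i := fun h => Finset.ne_of_mem_erase hm (σ.injective (h.trans hσi.symm))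
      by_cases hmj : σ m = j
      · simp [hmj]
      · simp [hmj, Equiv.swap_apply_of_ne_of_ne hmi hmj, hmi]

/-- If no permutation has positive weight, then there is a potential for the weights `b`. -/
theorem exists_potential [Fintype ι] [DecidableEq ι] {F : Type*} [AddCommGroup F] [LinearOrder F]
    [IsOrderedAddMonoid F] (b : ι → ι → WithBot F) (hb : ∀ i, b i i = 0)
    (hperm : ∀ σ : Equiv.Perm ι, ∑ i, b i (σ i) ≤ 0) :
    ∃ p : ι → F, ∀ i j, b i j + p j ≤ p i := by
  let S : ι → Finset {l : List ι // l.Nodup} := fun i => {l | (i :: l.1).Nodup}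
  -- The potential is the maximal weight of a simple walk from `i`, with free endpoint; simplicity
  -- makes the maximum finite.
  let q : ι → WithBot F := fun i => (S i).sup fun l => walkWeight b i l.1
  have le_q : ∀ i (l : List ι), (i :: l).Nodup → walkWeight b i l ≤ q i := fun i l hl =>
    Finset.le_sup (s := S i) (f := fun l => walkWeight b i l.1) (b := ⟨l, hl.of_cons⟩)
      (by simpa [S] using hl)
  have q_ne : ∀ i, q i ≠ ⊥ := fun i h => by
    have := le_q i [] (by simp)
    rw [h] at this
    exact absurd (le_bot_iff.mp this) WithBot.coe_ne_bot
  have cycle : ∀ i (l : List ι), (i :: l).Nodup → walkWeight b i (l ++ [i]) ≤ 0 := by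
    intro i l hl
    obtain ⟨σ, -, h⟩ := exists_perm_sum_eq_walkWeight b hb i l hl i
    rw [← h]
    refine le_of_eq_of_le (Finset.sum_congr rfl fun m _ => ?_) (hperm σ)
    split_ifs with hm
    · rw [hm]
    · rfl
  have hq : ∀ i j, b i j + q j ≤ q i := by
    intro i j
    have hne : (S j).Nonempty := ⟨⟨[], List.nodup_nil⟩, by simp [S]⟩
    obtain ⟨⟨l, hl⟩, hlS, hmax⟩ := Finset.exists_mem_eq_sup (S j) hne fun l => walkWeight b j l.1
    have hjl : (j :: l).Nodup := by simpa [S] using hlS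
    have hqj : q j = walkWeight b j l := hmax
    rw [hqj]
    change walkWeight b i (j :: l) ≤ q i
    -- If `i` already lies on the optimal walk from `j`, prepending `i` closes a cycle of weight at
    -- most zero, which can be dropped.
    by_cases hi : i ∈ j :: l
    · obtain ⟨l₁, l₂, h⟩ := List.append_of_mem hi
      rw [h] at hjl ⊢
      rw [walkWeight_append_cons]
      have h₁ : (i :: l₁).Nodup := by
        have := hjl.sublist (List.Sublist.append_left (List.singleton_sublist.mpr
          (List.mem_cons_self : i ∈ i :: l₂)) l₁)
        exact (List.perm_append_singleton i l₁).nodup_iff.mp this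
      have h₂ : (i :: l₂).Nodup := hjl.sublist (List.sublist_append_right _ _)
      simpa using add_le_add (cycle i l₁ h₁) (le_q i l₂ h₂)
    · exact le_q i _ (List.nodup_cons.mpr ⟨hi, hjl⟩)
  refine ⟨fun i => (q i).unbot (q_ne i), fun i j => ?_⟩
  simpa using hq i j

end Potential

/-! ### Tangible values and layers at a prescribed value -/

namespace ELT

section Valuation

variable {F L : Type*}

/-- The tangible value, as an element of `WithBot F`. -/
def val : Bar F L → WithBot F
  | none => ⊥
  | some x => (x.tangible : WithBot F)

@[simp] theorem val_zero : val (0 : Bar F L) = ⊥ := rfl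

@[simp] theorem val_coe (x : ELT F L) : val (x : Bar F L) = (x.tangible : WithBot F) := rfl

/-- The layer of an element if its tangible value is `c`, and zero otherwise. -/
def coeff [DecidableEq F] [Zero L] (c : F) : Bar F L → L
  | none => 0
  | some x => if x.tangible = c then x.layer else 0

@[simp] theorem coeff_zero [DecidableEq F] [Zero L] (c : F) : coeff c (0 : Bar F L) = 0 := rfl

@[simp] theorem coeff_coe [DecidableEq F] [Zero L] (c : F) (x : ELT F L) :
    coeff c (x : Bar F L) = if x.tangible = c then x.layer else 0 := rfl

@[simp] theorem s_coe [Zero L] (x : ELT F L) : s (x : Bar F L) = x.layer := rfl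

theorem coeff_eq_zero_of_s_eq_zero [DecidableEq F] [Zero L] (c : F) {x : Bar F L} (hx : s x = 0) :
    coeff c x = 0 := by
  induction x using WithZero.recZeroCoe with
  | zero => rfl
  | coe x => simp_all

theorem val_add [LinearOrder F] [AddCommSemigroup L] (x y : Bar F L) : val (x + y) = val x ⊔ val y := by
  induction x using WithZero.recZeroCoe with
  | zero => simp
  | coe x =>
    induction y using WithZero.recZeroCoe with
    | zero => simp
    | coe y =>
      rw [← WithZero.coe_add, add_def]
      simp only [val_coe, ← WithBot.coe_sup]
      split_ifs with h₁ h₂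
      · simp [h₁.le]
      · simp [h₂.le]
      · simp [le_antisymm (not_lt.mp h₁) (not_lt.mp h₂)]

theorem val_sum [LinearOrder F] [AddCommSemigroup L] {ι : Type*} (t : Finset ι)
    (f : ι → Bar F L) :
    val (∑ i ∈ t, f i) = t.sup fun i => val (f i) := by
  classical
  induction t using Finset.induction_on with
  | empty => rfl
  | insert a t ha ih => rw [Finset.sum_insert ha, Finset.sup_insert, val_add, ih]

/-- The bounds are essential: a summand of value above `c` would absorb a term of value `c`. -/
theorem coeff_add [LinearOrder F] [AddCommMonoid L] {c : F} {x y : Bar F L} (hx : val x ≤ c) (hy : val y ≤ c) :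
    coeff c (x + y) = coeff c x + coeff c y := by
  induction x using WithZero.recZeroCoe with
  | zero => simp
  | coe x =>
    induction y using WithZero.recZeroCoe with
    | zero => simp
    | coe y =>
      simp only [val_coe, WithBot.coe_le_coe] at hx hy
      rw [← WithZero.coe_add, add_def]
      simp only [coeff_coe]
      grind

theorem coeff_sum [LinearOrder F] [AddCommMonoid L] {ι : Type*} (t : Finset ι)
    (f : ι → Bar F L) (c : F)
    (hf : ∀ i ∈ t, val (f i) ≤ c) : coeff c (∑ i ∈ t, f i) = ∑ i ∈ t, coeff c (f i) := by
  classical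
  induction t using Finset.induction_on with
  | empty => rfl
  | insert a t ha ih =>
    have ht : ∀ i ∈ t, val (f i) ≤ c := fun i hi => hf i (Finset.mem_insert_of_mem hi)
    rw [Finset.sum_insert ha, Finset.sum_insert ha, coeff_add (hf a (Finset.mem_insert_self a t)),
      ih ht]
    rw [val_sum]
    exact Finset.sup_le ht

theorem isUnit_layer [AddCommMonoid F] [CommMonoid L] {d : ELT F L} (hd : IsUnit d) : IsUnit d.layer := by
  obtain ⟨d', hd'⟩ := isUnit_iff_exists_inv.mp hd
  exact isUnit_iff_exists_inv.mpr ⟨d'.layer, congrArg layer hd'⟩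

variable [AddCommGroup F] [LinearOrder F] [IsOrderedAddMonoid F] [CommRing L]

theorem val_mul (x y : Bar F L) : val (x * y) = val x + val y := by
  induction x using WithZero.recZeroCoe with
  | zero => simp
  | coe x =>
    induction y using WithZero.recZeroCoe with
    | zero => simp
    | coe y => rw [← WithZero.coe_mul, mul_def]; simp

theorem val_negation (x : Bar F L) : val (negation x) = val x := by
  rw [negation, val_mul, val_coe, WithBot.coe_zero, zero_add]

theorem val_prod {ι : Type*} (t : Finset ι) (f : ι → Bar F L) :
    val (∏ i ∈ t, f i) = ∑ i ∈ t, val (f i) := by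
  classical
  induction t using Finset.induction_on with
  | empty => rfl
  | insert a t ha ih => rw [Finset.prod_insert ha, Finset.sum_insert ha, val_mul, ih]

theorem val_det {n : ℕ} (A : Matrix (Fin n) (Fin n) (Bar F L)) :
    val (det A) = Finset.univ.sup fun σ : Equiv.Perm (Fin n) => ∑ i, val (A i (σ i)) := by
  have hun : (Finset.univ : Finset (Equiv.Perm (Fin n))) =
      Finset.univ.filter (fun σ => Equiv.Perm.sign σ = 1) ∪
        Finset.univ.filter (fun σ => Equiv.Perm.sign σ = -1) := by
    ext σ
    simpa using Int.units_eq_one_or (Equiv.Perm.sign σ)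
  rw [det, val_add, val_negation, val_sum, val_sum]
  conv_rhs => rw [hun, Finset.sup_union]
  simp only [val_prod]

/-- Under the bounds, a product reaches value `c + d` only if both factors reach theirs. -/
theorem coeff_mul {c d : F} {x y : Bar F L} (hx : val x ≤ c) (hy : val y ≤ d) :
    coeff (c + d) (x * y) = coeff c x * coeff d y := by
  induction x using WithZero.recZeroCoe with
  | zero => simp
  | coe x =>
    induction y using WithZero.recZeroCoe with
    | zero => simp
    | coe y =>
      simp only [val_coe, WithBot.coe_le_coe] at hx hy
      rw [← WithZero.coe_mul, mul_def]
      simp only [coeff_coe, add_eq_add_iff_eq_and_eq hx hy]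
      grind

theorem coeff_negation (c : F) (x : Bar F L) : coeff c (negation x) = -coeff c x := by
  induction x using WithZero.recZeroCoe with
  | zero => simp [negation]
  | coe x =>
    rw [negation, ← WithZero.coe_mul, mul_def]
    simp only [coeff_coe, zero_add, neg_mul, one_mul]
    split_ifs <;> simp

theorem coeff_prod {ι : Type*} (t : Finset ι) (f : ι → Bar F L) (c : ι → F)
    (hf : ∀ i ∈ t, val (f i) ≤ c i) :
    coeff (∑ i ∈ t, c i) (∏ i ∈ t, f i) = ∏ i ∈ t, coeff (c i) (f i) := by
  classical
  induction t using Finset.induction_on with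
  | empty =>
    change (if (0 : F) = 0 then (1 : L) else 0) = 1
    simp
  | insert a t ha ih =>
    have ht : ∀ i ∈ t, val (f i) ≤ c i := fun i hi => hf i (Finset.mem_insert_of_mem hi)
    rw [Finset.sum_insert ha, Finset.prod_insert ha, Finset.prod_insert ha,
      coeff_mul (hf a (Finset.mem_insert_self a t)), ih ht]
    rw [val_prod, WithBot.coe_sum]
    exact Finset.sum_le_sum ht

/-! ### Leading matrices and duality -/

/-- The matrix of leading layers of `A` with respect to the bounds `u i + w j`. -/
def leadingMatrix {n : ℕ} (A : Matrix (Fin n) (Fin n) (Bar F L)) (u w : Fin n → F) :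
    Matrix (Fin n) (Fin n) L :=
  Matrix.of fun i j => coeff (u i + w j) (A i j)

/-- The bounds along any permutation have the same total, so extracting layers at that total turns
the ELT determinant into the Leibniz formula. -/
theorem det_leadingMatrix {n : ℕ} (A : Matrix (Fin n) (Fin n) (Bar F L)) (u w : Fin n → F)
    (h : ∀ i j, val (A i j) ≤ ((u i + w j : F) : WithBot F)) :
    (leadingMatrix A u w).det = coeff (∑ i, u i + ∑ j, w j) (det A) := by
  have hbound : ∀ σ : Equiv.Perm (Fin n),
      ∑ i, (u i + w (σ i)) = ∑ i, u i + ∑ j, w j := fun σ => by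
    rw [Finset.sum_add_distrib, Equiv.sum_comp σ w]
  have hval : ∀ σ : Equiv.Perm (Fin n),
      val (∏ i, A i (σ i)) ≤ ((∑ i, u i + ∑ j, w j : F) : WithBot F) := fun σ => by
    rw [val_prod, ← hbound σ, WithBot.coe_sum]
    exact Finset.sum_le_sum fun i _ => h i (σ i)
  have hcoeff : ∀ σ : Equiv.Perm (Fin n), coeff (∑ i, u i + ∑ j, w j) (∏ i, A i (σ i)) =
      ∏ i, coeff (u i + w (σ i)) (A i (σ i)) := fun σ => by
    rw [← hbound σ, coeff_prod _ _ _ fun i _ => h i (σ i)]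
  have hsup : ∀ t : Finset (Equiv.Perm (Fin n)),
      val (∑ σ ∈ t, ∏ i, A i (σ i)) ≤ ((∑ i, u i + ∑ j, w j : F) : WithBot F) := fun t => by
    rw [val_sum]
    exact Finset.sup_le fun σ _ => hval σ
  rw [det, coeff_add (hsup _) (by rw [val_negation]; exact hsup _), coeff_negation,
    coeff_sum _ _ _ fun σ _ => hval σ, coeff_sum _ _ _ fun σ _ => hval σ,
    -- `Matrix.det_apply` permutes the row index, `ELT.det` the column index.
    ← Matrix.det_transpose, Matrix.det_apply,
    ← Finset.sum_filter_add_sum_filter_not _ (fun σ : Equiv.Perm (Fin n) => Equiv.Perm.sign σ = 1),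
    ← Finset.sum_neg_distrib]
  congr 1
  · refine Finset.sum_congr rfl fun σ hσ => ?_
    rw [(Finset.mem_filter.mp hσ).2, hcoeff]
    simp [leadingMatrix]
  · refine Finset.sum_congr (Finset.filter_congr fun σ _ => ?_) fun σ hσ => ?_
    · rcases Int.units_eq_one_or (Equiv.Perm.sign σ) with h | h <;> rw [h] <;> decide
    · rw [(Finset.mem_filter.mp hσ).2, hcoeff]
      simp [leadingMatrix]

theorem linIndep_col_of_isUnit_det_leadingMatrix {n : ℕ}
    (A : Matrix (Fin n) (Fin n) (Bar F L)) (u w : Fin n → F)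
    (h : ∀ i j, val (A i j) ≤ ((u i + w j : F) : WithBot F))
    (hdet : IsUnit (leadingMatrix A u w).det) : LinIndep A.col := by
  intro v hv hs j₀
  by_contra hj₀
  obtain ⟨k, -, hk⟩ := Finset.exists_max_image Finset.univ
    (fun j => val (v j) + (w j : WithBot F)) ⟨j₀, Finset.mem_univ j₀⟩
  obtain ⟨x₀, hx₀⟩ := WithZero.ne_zero_iff_exists.mp hj₀
  have hvk : v k ≠ 0 := by
    intro h0
    have := hk j₀ (Finset.mem_univ _)
    rw [h0, ← hx₀, val_zero, val_coe, WithBot.bot_add, ← WithBot.coe_add] at this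
    exact absurd (le_bot_iff.mp this) WithBot.coe_ne_bot
  obtain ⟨x, hx⟩ := WithZero.ne_zero_iff_exists.mp hvk
  -- With `c` the maximum of `val (v j) + w j`, every term in row `i` of the combination has value
  -- at most `u i + c`.
  set c : F := x.tangible + w k with hc
  have hbound : ∀ j, val (v j) ≤ ((c - w j : F) : WithBot F) := by
    intro j
    have := hk j (Finset.mem_univ _)
    rw [← hx, val_coe, ← WithBot.coe_add, ← hc] at this
    rcases eq_or_ne (v j) 0 with h0 | h0
    · simp [h0]
    · obtain ⟨y, hy⟩ := WithZero.ne_zero_iff_exists.mp h0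
      rw [← hy, val_coe, ← WithBot.coe_add, WithBot.coe_le_coe] at this
      rw [← hy, val_coe, WithBot.coe_le_coe]
      exact le_sub_iff_add_le.mpr this
  have hmul : (leadingMatrix A u w).mulVec (fun j => coeff (c - w j) (v j)) = 0 := by
    funext i
    have hterm : ∀ j, u i + c = (c - w j) + (u i + w j) := fun j => by abel
    have hsum := coeff_eq_zero_of_s_eq_zero (u i + c) (hs i)
    rw [Finset.sum_apply, coeff_sum] at hsum
    · rw [Pi.zero_apply, ← hsum]
      change ∑ j, leadingMatrix A u w i j * coeff (c - w j) (v j) = _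
      refine Finset.sum_congr rfl fun j _ => ?_
      change _ = coeff (u i + c) (v j * A i j)
      rw [hterm j, coeff_mul (hbound j) (h i j), mul_comm]
      rfl
    · intro j _
      change val (v j * A i j) ≤ _
      rw [val_mul, hterm j, WithBot.coe_add]
      exact add_le_add (hbound j) (h i j)
  have hzero := congrFun (Matrix.mulVec_injective_of_isUnit
    ((Matrix.isUnit_iff_isUnit_det _).mpr hdet) (hmul.trans (Matrix.mulVec_zero _).symm)) k
  rw [← hx] at hzero
  simp only [coeff_coe, hc, add_sub_cancel_right, if_true, Pi.zero_apply] at hzero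
  rcases hv k with h' | h'
  · exact hvk h'
  · rw [← hx] at h'
    exact h' hzero

/-- Linear programming duality for the assignment problem given by the tangible values of `A`. -/
theorem exists_bounds_of_val_det {n : ℕ} (A : Matrix (Fin n) (Fin n) (Bar F L)) (D : F)
    (hD : val (det A) = D) :
    ∃ u w : Fin n → F, (∀ i j, val (A i j) ≤ ((u i + w j : F) : WithBot F)) ∧
      ∑ i, u i + ∑ j, w j = D := by
  rw [val_det] at hD
  obtain ⟨τ, -, hτ⟩ := Finset.exists_mem_eq_sup (Finset.univ : Finset (Equiv.Perm (Fin n)))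
    Finset.univ_nonempty fun σ : Equiv.Perm (Fin n) => ∑ i, val (A i (σ i))
  have hsum : ∑ i, val (A i (τ i)) = D := hτ.symm.trans hD
  have hne : ∀ i, val (A i (τ i)) ≠ ⊥ := fun i h => by
    rw [← Finset.add_sum_erase _ _ (Finset.mem_univ i), h, WithBot.bot_add] at hsum
    exact WithBot.bot_ne_coe hsum
  choose e he using fun i => WithBot.ne_bot_iff_exists.mp (hne i)
  have hsum' : ∑ i, e i = D := by
    simp only [← he, ← WithBot.coe_sum] at hsum
    exact WithBot.coe_injective hsum
  -- Relabelling columns by the optimal `τ` and subtracting its entries gives the identity weight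
  -- zero; optimality of `τ` then bounds every permutation weight by zero.
  obtain ⟨p, hp⟩ := exists_potential (fun i j => val (A i (τ j)) + ((-e j : F) : WithBot F))
    (fun i => by rw [← he, ← WithBot.coe_add, add_neg_cancel, WithBot.coe_zero])
    (fun σ => by
      rw [Finset.sum_add_distrib, ← WithBot.coe_sum, Equiv.sum_comp σ fun j => -e j,
        Finset.sum_neg_distrib, hsum']
      have hle : ∑ i, val (A i (τ (σ i))) ≤ (D : WithBot F) := by
        rw [← hD]
        exact Finset.le_sup (f := fun σ : Equiv.Perm (Fin n) => ∑ i, val (A i (σ i)))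
          (Finset.mem_univ (τ * σ))
      refine (add_le_add_left hle _).trans_eq ?_
      rw [← WithBot.coe_add, add_neg_cancel, WithBot.coe_zero])
  -- This `w` makes the bounds tight along `τ`, so they sum to `D`.
  refine ⟨p, fun j => e (τ.symm j) - p (τ.symm j), fun i j => ?_, ?_⟩
  · have := hp i (τ.symm j)
    simp only [Equiv.apply_symm_apply] at this
    rcases eq_or_ne (A i j) 0 with h0 | h0
    · simp [h0]
    · obtain ⟨y, hy⟩ := WithZero.ne_zero_iff_exists.mp h0
      rw [← hy, val_coe] at this ⊢
      rw [← WithBot.coe_add, ← WithBot.coe_add, WithBot.coe_le_coe] at this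
      rw [WithBot.coe_le_coe]
      calc y.tangible = (y.tangible + -e (τ.symm j) + p (τ.symm j)) +
            (e (τ.symm j) - p (τ.symm j)) := by abel
        _ ≤ _ := by gcongr
  · rw [Equiv.sum_comp τ.symm fun j => e j - p j, Finset.sum_sub_distrib, hsum']
    abel

end Valuation

end ELT

theorem mainTheorem5 {F L : Type*} [AddCommGroup F] [LinearOrder F] [IsOrderedAddMonoid F]
    [CommRing L] (n : ℕ) (A : Matrix (Fin n) (Fin n) (ELT.Bar F L))
    (hA : ∃ d : ELT F L, IsUnit d ∧ ELT.det A = (d : ELT.Bar F L)) :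
    ELT.LinIndep A.col ∧ ELT.LinIndep A.row := by
  obtain ⟨d, hd, hdet⟩ := hA
  obtain ⟨u, w, h, hsum⟩ := ELT.exists_bounds_of_val_det A d.tangible (by rw [hdet, ELT.val_coe])
  have hunit : IsUnit (ELT.leadingMatrix A u w).det := by
    rw [ELT.det_leadingMatrix A u w h, hsum, hdet, ELT.coeff_coe, if_pos rfl]
    exact ELT.isUnit_layer hd
  refine ⟨ELT.linIndep_col_of_isUnit_det_leadingMatrix A u w h hunit,
    ELT.linIndep_col_of_isUnit_det_leadingMatrix A.transpose w u
      (fun i j => by rw [add_comm]; exact h j i) ?_⟩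
  have htr : ELT.leadingMatrix A.transpose w u = (ELT.leadingMatrix A u w).transpose := by
    ext i j
    simp [ELT.leadingMatrix, add_comm]
  rwa [htr, Matrix.det_transpose]
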